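/- For $n\ge 0$ let $(a;q)_n=\prod_{j=0}^{n-1}(1-aq^j)$ and, for $N\ge0$, let $$F(q,N)=\sum_{n=0}^{N}(q;q)_n .$$ For a prime $p$, let the polynomials $A_p(N,i,q)\in\mathbb{Z}[q]$ $(0\le i\le p-1)$ be the components of the $p$-dissection of $F(q,N)$, that is, the unique polynomials with $$F(q,N)=\sum_{i=0}^{p-1}q^i A_p(N,i,q^p).$$ For $n\ge1$ define the integers $\alpha(p,n,i,k)$ by $$A_p(pn-1,i,1-q)=\sum_{k\ge0}\alpha(p,n,i,k)\,q^k .$$ For a formal power series $u\in\mathbb{Z}[[q]]$ with constant term $1$ put $F(u)=\sum_{n\ge0}(u;u)_n\in\mathbb{Z}[[q]]$ (a well-defined formal power series, since $(u;u)_n$ is divisible by $q^n$), and define integers $\bar\xi_p(n)$ by $$\sum_{n=0}^\infty\bar\xi_p(n)\,q^n=(1-q)^{\lfloor p/24\rfloor}F\big((1-q)^p\big).$$ **Theorem.** Let $p\ge5$ be prime and let $1\le i_0\le p-1$ satisfy $24i_0\equiv-1\pmod p$. Then for every $n\ge1$ and every $0\le k\le n-1$, $$\alpha(p,n,i_0,k)=p\left(\frac{12}{p}\right)\bar\xi_p(k),$$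 where $\left(\frac{\cdot}{\cdot}\right)$ is the Kronecker symbol. -/

import Mathlib

namespace Fishburn

open Finset

/-- The `q`-shifted factorial `(a; q)_n = (1 - a)(1 - a q) ⋯ (1 - a q ^ (n - 1))`. -/
def qPoch {R : Type*} [CommRing R] (a q : R) (n : ℕ) : R :=
  ∏ j ∈ range n, (1 - a * q ^ j)

/-- The truncation `F(q, N) = ∑_{n = 0}^{N} (q; q)_n`, a polynomial in `q`. -/
noncomputable def truncF (N : ℕ) : Polynomial ℤ :=
  ∑ n ∈ range (N + 1), qPoch Polynomial.X Polynomial.X n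

/-- The `i`-th component `A` of the `p`-dissection `f(q) = ∑_{i < p} q ^ i A_i(q ^ p)` of a
polynomial `f`: the coefficient of `q ^ m` in `A` is that of `q ^ (p m + i)` in `f`
(see `sum_dissect` and `eq_dissect`). -/
noncomputable def dissect (p i : ℕ) (f : Polynomial ℤ) : Polynomial ℤ :=
  ∑ m ∈ range (f.natDegree + 1), Polynomial.monomial m (f.coeff (p * m + i))

lemma coeff_dissect {p : ℕ} (hp : 0 < p) (i : ℕ) (f : Polynomial ℤ) (m : ℕ) :
    (dissect p i f).coeff m = f.coeff (p * m + i) := by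
  simp only [dissect, Polynomial.finsetSum_coeff, Polynomial.coeff_monomial,
    Finset.sum_ite_eq', mem_range]
  split_ifs with h
  · rfl
  · refine (Polynomial.coeff_eq_zero_of_natDegree_lt ?_).symm
    have := Nat.le_mul_of_pos_left m hp
    omega

/-- The coefficients of a sum `∑_{i < p} q ^ i B_i(q ^ p)`. -/
lemma coeff_sum_expand {p i : ℕ} (hi : i < p) (B : ℕ → Polynomial ℤ) (m : ℕ) :
    (∑ j ∈ range p, Polynomial.X ^ j * (B j).comp (Polynomial.X ^ p)).coeff (p * m + i) =
      (B i).coeff m := by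
  have hp : 0 < p := by omega
  rw [Polynomial.finsetSum_coeff, Finset.sum_eq_single i]
  · rw [Polynomial.coeff_X_pow_mul, ← Polynomial.expand_eq_comp_X_pow,
      Polynomial.coeff_expand hp]
    simp [hp]
  · intro j hj hji
    have hj' := mem_range.1 hj
    rw [Polynomial.coeff_X_pow_mul', ← Polynomial.expand_eq_comp_X_pow,
      Polynomial.coeff_expand hp]
    split_ifs with h1 h2
    · exfalso
      apply hji
      have h3 : p * m + i ≡ j [MOD p] := ((Nat.modEq_iff_dvd' h1).2 h2).symm
      have h4 : i % p = j % p := by simpa [Nat.ModEq] using h3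
      rw [Nat.mod_eq_of_lt hi, Nat.mod_eq_of_lt hj'] at h4
      exact h4.symm
    · rfl
    · rfl
  · intro h
    exact absurd (mem_range.2 hi) h

/-- The `p`-dissection. -/
lemma sum_dissect {p : ℕ} (hp : 0 < p) (f : Polynomial ℤ) :
    f = ∑ i ∈ range p, Polynomial.X ^ i * (dissect p i f).comp (Polynomial.X ^ p) := by
  ext m
  have h := coeff_sum_expand (Nat.mod_lt m hp) (fun i => dissect p i f) (m / p)
  rw [coeff_dissect hp, Nat.div_add_mod] at h
  exact h.symm

/-- The components of the `p`-dissection are unique. -/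
lemma eq_dissect {p : ℕ} (f : Polynomial ℤ) (B : ℕ → Polynomial ℤ)
    (hB : f = ∑ i ∈ range p, Polynomial.X ^ i * (B i).comp (Polynomial.X ^ p))
    {i : ℕ} (hi : i < p) : B i = dissect p i f := by
  ext m
  rw [coeff_dissect (by omega), ← coeff_sum_expand hi B m, ← hB]

/-- `A_p(N, i, q)`, where `F(q, N) = ∑_{i < p} q ^ i A_p(N, i, q ^ p)`. -/
noncomputable def A (p N i : ℕ) : Polynomial ℤ :=
  dissect p i (truncF N)

/-- `α(p, n, i, k)`, the coefficient of `q ^ k` in `A_p(p n - 1, i, 1 - q)` (for `n ≥ 1`). -/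
noncomputable def alpha (p n i k : ℕ) : ℤ :=
  ((A p (p * n - 1) i).comp (1 - Polynomial.X)).coeff k

/-- The formal power series `F(u) = ∑_{n ≥ 0} (u; u)_n`, for a power series `u` in `q` with
constant term `1`. It is summed coefficient by coefficient; each coefficient is a finite sum
by `coeff_qPoch_eq_zero`. -/
noncomputable def F (u : PowerSeries ℤ) : PowerSeries ℤ :=
  PowerSeries.mk fun k => ∑ᶠ n : ℕ, PowerSeries.coeff k (qPoch u u n)

lemma X_pow_dvd_qPoch {u : PowerSeries ℤ} (hu : PowerSeries.constantCoeff u = 1) (n : ℕ) :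
    PowerSeries.X ^ n ∣ qPoch u u n := by
  induction n with
  | zero => simp
  | succ n ih =>
    rw [qPoch, prod_range_succ, pow_succ]
    refine mul_dvd_mul ih ?_
    rw [PowerSeries.X_dvd_iff]
    simp [hu]

lemma coeff_qPoch_eq_zero {u : PowerSeries ℤ} (hu : PowerSeries.constantCoeff u = 1)
    {n k : ℕ} (h : k < n) : PowerSeries.coeff k (qPoch u u n) = 0 :=
  PowerSeries.X_pow_dvd_iff.1 (X_pow_dvd_qPoch hu n) k h

lemma coeff_F {u : PowerSeries ℤ} (hu : PowerSeries.constantCoeff u = 1) (k : ℕ) :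
    PowerSeries.coeff k (F u) =
      ∑ n ∈ range (k + 1), PowerSeries.coeff k (qPoch u u n) := by
  rw [F, PowerSeries.coeff_mk]
  refine finsum_eq_sum_of_support_subset _ fun n hn => ?_
  by_contra h
  exact hn (coeff_qPoch_eq_zero hu (by simpa using h))

/-- `ξ̄_p(n)`, the coefficient of `q ^ n` in `(1 - q) ^ ⌊p / 24⌋ F((1 - q) ^ p)`. -/
noncomputable def xiBar (p n : ℕ) : ℤ :=
  PowerSeries.coeff n
    ((1 - PowerSeries.X) ^ (p / 24) * F ((1 - PowerSeries.X) ^ p))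

end Fishburn

namespace Fishburn

open Finset

/-! ### The functional equation of `partialG` and its error terms. -/

section Generic

variable {R : Type*} [CommRing R]

/-! Deform the truncated sum to G(x, q) = ∑ xⁿ (xq; q)_n, which satisfies a functional equation
under x ↦ qx (`partialG_functional_equation`). Iterating it p times relates (1 - x) G(x, q) to its
image under x ↦ q^p x, up to a partial theta sum and boundary terms that are small for the powers of
the ideal (1 - q^p, 1 - x). In the component i₀ the theta sum keeps only two monomials
(`componentHom_theta`), which gives D + c σ(D) ≡ T modulo a power of I = (1 - q, 1 - x), with σ : x
↦ qx.

The function (12/p) q^⌊p/24⌋ x^((p-1)/2) (1 - x^p) G(x^p, q^p) satisfies the same congruence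
(`partialG_pow_add_mem`). Solutions are unique up to a power of 2 (`exists_two_pow_mul_mem`),
because σ is unipotent on I^k / I^(k+1) and so cannot act as -1 away from 2. Dividing the difference
by 1 - x and setting x = 1 costs one power of 1 - q and turns (1 - x^p)/(1 - x) into the factor p
(`dvd_map_eval_of_mem`). Finally q ↦ 1 - q converts divisibility by (1 - q)^n into agreement of the
coefficients below n. -/

lemma qPoch_succ (a q : R) (n : ℕ) : qPoch a q (n + 1) = qPoch a q n * (1 - a * q ^ n) :=
  prod_range_succ _ _

lemma map_qPoch {R' : Type*} [CommRing R'] (f : R →+* R') (a q : R) (n : ℕ) :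
    f (qPoch a q n) = qPoch (f a) (f q) n := by
  simp [qPoch]

/-- The partial sum `∑_{n < N} x ^ n (x q; q)_n`. -/
def partialG (x q : R) (N : ℕ) : R := ∑ n ∈ range N, x ^ n * qPoch (x * q) q n

lemma map_partialG {R' : Type*} [CommRing R'] (f : R →+* R') (x q : R) (N : ℕ) :
    f (partialG x q N) = partialG (f x) (f q) N := by
  simp [partialG, map_qPoch]

/-- The boundary term in the functional equation of `(1 - x) ∑_{n < N} x ^ n (x q; q)_n`. -/
def boundary (x q : R) (N : ℕ) : R :=
  x ^ N * qPoch (x * q) q N * (1 - x ^ 2 * q ^ (N + 1))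

lemma one_sub_mul_qPoch_shift (a q : R) (n : ℕ) :
    (1 - a) * qPoch (a * q) q n = qPoch a q n * (1 - a * q ^ n) := by
  rw [← qPoch_succ, qPoch, qPoch, prod_range_succ', mul_comm]
  simp [pow_succ', mul_assoc]

lemma partialG_functional_equation (x q : R) (N : ℕ) :
    (1 - x) * partialG x q N =
      1 - q * x ^ 2 - boundary x q N - q ^ 2 * x ^ 3 * ((1 - q * x) * partialG (q * x) q N) := by
  induction N with
  | zero => simp [partialG, boundary, qPoch]; ring
  | succ N ih =>
    have h := one_sub_mul_qPoch_shift (x * q) q N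
    have e : q * x * q = x * q * q := by ring
    simp only [partialG, sum_range_succ, mul_add, boundary, qPoch_succ, e] at ih ⊢
    rw [ih]
    have h' : (1 - q * x) * ((q * x) ^ N * qPoch (x * q * q) q N) =
        (q * x) ^ N * (qPoch (x * q) q N * (1 - x * q * q ^ N)) := by
      rw [← h]; ring
    rw [h']
    ring

/-- The exponents `j (3 j + 1) / 2`. -/
def pent (j : ℕ) : ℕ := j * (3 * j + 1) / 2

lemma two_mul_pent (j : ℕ) : 2 * pent j = j * (3 * j + 1) := by
  refine Nat.mul_div_cancel' ?_
  rcases Nat.even_or_odd j with h | h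
  · exact (h.mul_right _).two_dvd
  · refine (Even.mul_left ?_ _).two_dvd
    have : Odd (3 * j) := Odd.mul (by decide) h
    exact this.add_one

lemma pent_succ (j : ℕ) : pent (j + 1) = pent j + 3 * j + 2 := by
  have h1 := two_mul_pent j
  have h2 := two_mul_pent (j + 1)
  nlinarith

lemma partialG_iterate (x q : R) (N j : ℕ) :
    (1 - x) * partialG x q N =
      ∑ i ∈ range j, (-1) ^ i * q ^ pent i * x ^ (3 * i) *
        (1 - q ^ (2 * i + 1) * x ^ 2 - boundary (q ^ i * x) q N) +
      (-1) ^ j * q ^ pent j * x ^ (3 * j) * ((1 - q ^ j * x) * partialG (q ^ j * x) q N) := by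
  induction j with
  | zero => simp [pent]
  | succ j ih =>
    rw [ih, sum_range_succ, partialG_functional_equation (q ^ j * x), pent_succ,
      ← mul_assoc q, ← pow_succ']
    ring

lemma one_sub_pow_mul_pow_mem (x y : R) (a b : ℕ) :
    1 - x ^ a * y ^ b ∈ Ideal.span {1 - y, 1 - x} := by
  have hy : Ideal.Quotient.mk (Ideal.span {1 - y, 1 - x}) y = 1 :=
    (Ideal.Quotient.mk_eq_mk_iff_sub_mem 1 y |>.2 (Ideal.subset_span (by simp))).symm
  have hx : Ideal.Quotient.mk (Ideal.span {1 - y, 1 - x}) x = 1 :=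
    (Ideal.Quotient.mk_eq_mk_iff_sub_mem 1 x |>.2 (Ideal.subset_span (by simp))).symm
  rw [← Ideal.Quotient.eq_zero_iff_mem]
  simp [hx, hy]

/-- Among any p consecutive factors 1 - x q^m, one has p ∣ m and so lies in the ideal; each block of
p factors contributes one power. -/
lemma qPoch_mem_pow (x q : R) {p : ℕ} (hp : 0 < p) (j t : ℕ) :
    qPoch (x * q ^ j) q (p * t) ∈ Ideal.span {1 - q ^ p, 1 - x} ^ t := by
  induction t with
  | zero => simp
  | succ t ih =>
    rw [qPoch, mul_add, mul_one, prod_range_add, pow_succ]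
    refine Ideal.mul_mem_mul ih ?_
    obtain ⟨i, hi, c, hc⟩ : ∃ i < p, p ∣ j + (p * t + i) := by
      refine ⟨(p - (j % p)) % p, Nat.mod_lt _ hp, ?_⟩
      have h1 := Nat.mod_lt j hp
      have h2 := Nat.div_add_mod j p
      rcases Nat.eq_zero_or_pos (j % p) with h | h
      · rw [h] at h2 ⊢
        rw [← h2]
        simp
        exact ⟨j / p + t, by ring⟩
      · rw [Nat.mod_eq_of_lt (by omega)]
        refine ⟨j / p + t + 1, ?_⟩
        zify [h1.le]
        zify at h2
        linear_combination -h2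
    refine Ideal.mem_of_dvd _ (dvd_prod_of_mem _ (mem_range.2 hi)) ?_
    rw [mul_assoc, ← pow_add, hc, pow_mul]
    simpa using one_sub_pow_mul_pow_mem x (q ^ p) 1 c

lemma partialG_iterate_of_odd (x q : R) (N : ℕ) {j : ℕ} (hj : Odd j) :
    (1 - x) * partialG x q N =
      ∑ i ∈ range j, (-1) ^ i * q ^ pent i * x ^ (3 * i) * (1 - q ^ (2 * i + 1) * x ^ 2) -
      ∑ i ∈ range j, (-1) ^ i * q ^ pent i * x ^ (3 * i) * boundary (q ^ i * x) q N -
      q ^ pent j * x ^ (3 * j) * ((1 - q ^ j * x) * partialG (q ^ j * x) q N) := by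
  rw [partialG_iterate x q N j, hj.neg_one_pow, ← sum_sub_distrib]
  simp only [← mul_sub]
  ring

lemma boundary_mem_pow (x q : R) {p : ℕ} (hp : 0 < p) (j t : ℕ) :
    boundary (q ^ j * x) q (p * t) ∈ Ideal.span {1 - q ^ p, 1 - x} ^ t := by
  rw [boundary, show q ^ j * x * q = x * q ^ (j + 1) by ring]
  exact Ideal.mul_mem_right _ _ (Ideal.mul_mem_left _ _ (qPoch_mem_pow _ _ hp _ _))

lemma boundary_pow_mem_pow (x q : R) (p t : ℕ) :
    boundary (x ^ p) (q ^ p) t ∈ Ideal.span {1 - q, 1 - x} ^ t := by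
  refine Ideal.mul_mem_right _ _ (Ideal.mul_mem_left _ _ ?_)
  induction t with
  | zero => simp
  | succ t ih =>
    rw [qPoch_succ]
    have h := Ideal.mul_mem_mul ih (one_sub_pow_mul_pow_mem x q p (p + p * t))
    rwa [← pow_succ, pow_add q, pow_mul, ← mul_assoc] at h

lemma neg_one_pow_five_mul (r : ℕ) : (-1 : R) ^ (5 * r) = (-1) ^ r := by
  rw [pow_mul]; norm_num

end Generic

/-! ### Uniqueness of solutions of D + c σ(D) ≡ T modulo powers of an ideal. -/

section Rigidity

variable {S : Type*} [CommRing S]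

lemma sub_mem_pow_of_shift {h y : S} {σ : S →+* S} (hσ : ∀ a, h ∣ σ a - a)
    (m : ℕ) {a : S} (ha : a ∈ Ideal.span {h, y} ^ (m + 1)) :
    ∃ b ∈ Ideal.span {h, y} ^ m, σ a - a = h * b := by
  induction m generalizing a with
  | zero => obtain ⟨b, hb⟩ := hσ a; exact ⟨b, by simp, hb⟩
  | succ m ih =>
    rw [pow_succ] at ha
    refine Submodule.mul_induction_on ha (fun u hu v hv => ?_) (fun u v hu hv => ?_)
    · obtain ⟨b, hb, e⟩ := ih hu
      obtain ⟨c, hc⟩ := hσ v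
      refine ⟨b * σ v + u * c, add_mem ?_ (Ideal.mul_mem_right _ _ hu), ?_⟩
      · rw [pow_succ]
        refine Ideal.mul_mem_mul hb ?_
        have : σ v = v + h * c := by rw [← hc]; ring
        rw [this]
        exact add_mem hv (Ideal.mul_mem_right _ _ (Ideal.subset_span (by simp)))
      · rw [map_mul]
        linear_combination σ v * e + u * hc
    · obtain ⟨b, hb, e⟩ := hu
      obtain ⟨c, hc, e'⟩ := hv
      exact ⟨b + c, add_mem hb hc, by rw [map_add]; linear_combination e + e'⟩

lemma map_mem_pow_of_shift {h y : S} {σ : S →+* S} (hσ : ∀ a, h ∣ σ a - a)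
    {m : ℕ} {a : S} (ha : a ∈ Ideal.span {h, y} ^ m) : σ a ∈ Ideal.span {h, y} ^ m := by
  cases m with
  | zero => simp
  | succ m =>
    obtain ⟨b, hb, e⟩ := sub_mem_pow_of_shift hσ m ha
    rw [sub_eq_iff_eq_add.1 e, pow_succ']
    refine add_mem (Ideal.mul_mem_mul (Ideal.subset_span (by simp)) hb) ?_
    rwa [← pow_succ']

/-- Modulo I^(k+1), σ - 1 acts on D as -2, while each application of σ - 1 trades one power of the
ideal for an explicit factor h. After k + 1 applications the result is a multiple of h^(k+1), hence
zero modulo I^(k+1). -/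
lemma mem_pow_of_add_shift_mem {h y : S} {σ : S →+* S} (hσ : ∀ a, h ∣ σ a - a) (hh : σ h = h)
    {k : ℕ} {D : S} (hD : D ∈ Ideal.span {h, y} ^ k)
    (hs : D + σ D ∈ Ideal.span {h, y} ^ (k + 1)) :
    2 ^ (k + 1) * D ∈ Ideal.span {h, y} ^ (k + 1) := by
  have key : ∀ j ≤ k, ∃ b ∈ Ideal.span {h, y} ^ (k - j),
      (-2) ^ j * D - h ^ j * b ∈ Ideal.span {h, y} ^ (k + 1) := by
    intro j
    induction j with
    | zero => intro _; exact ⟨D, by simpa using hD, by simp⟩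
    | succ j ih =>
      intro hj
      obtain ⟨b, hb, e⟩ := ih (by omega)
      obtain ⟨c, hc, e'⟩ := sub_mem_pow_of_shift hσ (k - (j + 1)) (a := b)
        (by rwa [show k - (j + 1) + 1 = k - j by omega])
      refine ⟨c, hc, ?_⟩
      have h1 := sub_mem (map_mem_pow_of_shift hσ e) e
      have h2 := sub_mem h1 (Ideal.mul_mem_left _ ((-2) ^ j) hs)
      convert h2 using 1
      simp only [map_sub, map_mul, map_pow, hh, map_neg, map_ofNat]
      linear_combination h ^ j * e'
  obtain ⟨b, hb, e⟩ := key k le_rfl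
  obtain ⟨c, hc⟩ := hσ b
  have h1 := sub_mem (map_mem_pow_of_shift hσ e) e
  have h2 := sub_mem h1 (Ideal.mul_mem_left _ ((-2) ^ k) hs)
  have h3 : h ^ (k + 1) * c ∈ Ideal.span {h, y} ^ (k + 1) :=
    Ideal.mul_mem_right _ _ (Ideal.pow_mem_pow (Ideal.subset_span (by simp)) _)
  have h4 := Ideal.mul_mem_left _ ((-1) ^ (k + 1)) (add_mem h2 h3)
  convert h4 using 1
  simp only [map_sub, map_mul, map_pow, hh, map_neg, map_ofNat]
  rw [show (2 : S) ^ (k + 1) = (-1) ^ (k + 1) * (-2) ^ (k + 1) by rw [← mul_pow]; norm_num]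
  linear_combination (-1) ^ (k + 1) * h ^ k * hc

lemma exists_two_pow_mul_mem {h y : S} {σ : S →+* S} (hσ : ∀ a, h ∣ σ a - a) (hh : σ h = h)
    {c D : S} (hc : 1 - c ∈ Ideal.span {h, y}) (k : ℕ)
    (hs : D + c * σ D ∈ Ideal.span {h, y} ^ k) :
    ∃ M : ℕ, 2 ^ M * D ∈ Ideal.span {h, y} ^ k := by
  induction k with
  | zero => simp
  | succ k ih =>
    obtain ⟨M, hM⟩ := ih (Ideal.pow_le_pow_right (by omega) hs)
    refine ⟨k + 1 + M, ?_⟩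
    rw [pow_add 2, mul_assoc]
    refine mem_pow_of_add_shift_mem hσ hh hM ?_
    have h1 := Ideal.mul_mem_mul hc (map_mem_pow_of_shift hσ hM)
    rw [← pow_succ'] at h1
    have h2 := add_mem (Ideal.mul_mem_left _ (2 ^ M) hs) h1
    convert h2 using 1
    simp only [map_mul, map_pow, map_ofNat]
    ring

end Rigidity

lemma span_pair_pow_induction {S : Type*} [CommRing S] {h y : S} {k : ℕ} {P : S → Prop} {f : S}
    (hf : f ∈ Ideal.span {h, y} ^ (k + 1))
    (hl : ∀ u ∈ Ideal.span {h, y} ^ k, P (h * u)) (hr : ∀ u ∈ Ideal.span {h, y} ^ k, P (y * u))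
    (hadd : ∀ u v, P u → P v → P (u + v)) : P f := by
  rw [pow_succ] at hf
  refine Submodule.mul_induction_on hf (fun u hu v hv => ?_) hadd
  obtain ⟨c, d, rfl⟩ := Ideal.mem_span_pair.1 hv
  rw [show u * (c * h + d * y) = h * (u * c) + y * (u * d) by ring]
  exact hadd _ _ (hl _ (Ideal.mul_mem_right _ _ hu)) (hr _ (Ideal.mul_mem_right _ _ hu))

/-! ### Dissection of polynomials over a general coefficient ring. -/

section Component

open Polynomial

variable {B : Type*} [CommRing B]

/-- The `i`-th component of the `p`-dissection of a polynomial over any commutative ring. -/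
noncomputable def component (p i : ℕ) (f : B[X]) : B[X] :=
  ∑ m ∈ range (f.natDegree + 1), monomial m (f.coeff (p * m + i))

lemma coeff_component {p : ℕ} (hp : 0 < p) (i : ℕ) (f : B[X]) (m : ℕ) :
    (component p i f).coeff m = f.coeff (p * m + i) := by
  simp only [component, finsetSum_coeff, coeff_monomial, Finset.sum_ite_eq', mem_range]
  split_ifs with h
  · rfl
  · refine (coeff_eq_zero_of_natDegree_lt ?_).symm
    have := Nat.le_mul_of_pos_left m hp
    omega

/-- `component` as an additive homomorphism. -/
noncomputable def componentHom {p : ℕ} (hp : 0 < p) (i : ℕ) : B[X] →+ B[X] where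
  toFun := component p i
  map_zero' := by ext; simp [coeff_component hp]
  map_add' f g := by ext; simp [coeff_component hp]

variable {p i : ℕ} (hp : 0 < p)

lemma coeff_componentHom (f : B[X]) (m : ℕ) :
    (componentHom hp i f).coeff m = f.coeff (p * m + i) := coeff_component hp i f m

lemma componentHom_expand_mul (hi : i < p) (a f : B[X]) :
    componentHom hp i (expand B p a * f) = a * componentHom hp i f := by
  induction a using Polynomial.induction_on' with
  | add a b ha hb => rw [map_add, add_mul, map_add, ha, hb, add_mul]
  | monomial n c =>
    ext m
    rw [expand_monomial, coeff_componentHom, ← C_mul_X_pow_eq_monomial, ← C_mul_X_pow_eq_monomial,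
      mul_assoc, mul_assoc, coeff_C_mul, coeff_C_mul, coeff_X_pow_mul', coeff_X_pow_mul',
      coeff_componentHom]
    by_cases h : n ≤ m
    · have h' : p * n ≤ p * m := Nat.mul_le_mul_left p h
      rw [if_pos (by nlinarith), if_pos h, Nat.mul_sub, mul_comm n p]
      congr 2
      omega
    · have h' : p * (m + 1) ≤ p * n := Nat.mul_le_mul_left p (by omega)
      rw [if_neg h, if_neg (by nlinarith)]

lemma componentHom_C_mul (b : B) (f : B[X]) :
    componentHom hp i (C b * f) = C b * componentHom hp i f := by
  ext; simp [coeff_componentHom]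

lemma componentHom_X_pow_mul_add (f : ℕ) :
    componentHom hp i (X ^ (p * f + i) : B[X]) = X ^ f := by
  ext m
  rw [coeff_componentHom, coeff_X_pow, coeff_X_pow]
  simp [hp.ne']

lemma componentHom_X_pow_eq_zero (hi : i < p) {e : ℕ} (he : e % p ≠ i) :
    componentHom hp i (X ^ e : B[X]) = 0 := by
  ext m
  rw [coeff_componentHom, coeff_X_pow, if_neg, coeff_zero]
  rintro rfl
  exact he (by rw [Nat.mul_add_mod, Nat.mod_eq_of_lt hi])

lemma componentHom_map {B' : Type*} [CommRing B'] (g : B →+* B') (f : B[X]) :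
    componentHom hp i (f.map g) = (componentHom hp i f).map g := by
  ext; simp [coeff_componentHom]

lemma componentHom_mem_pow (hi : i < p) (b : B) (k : ℕ) {f : B[X]}
    (hf : f ∈ Ideal.span {1 - X ^ p, 1 - C b} ^ k) :
    componentHom hp i f ∈ Ideal.span {1 - X, 1 - C b} ^ k := by
  induction k generalizing f with
  | zero => simp
  | succ k ih =>
    have e : ∀ u : B[X], componentHom hp i ((1 - X ^ p) * u) = (1 - X) * componentHom hp i u := by
      intro u
      rw [← componentHom_expand_mul hp hi, map_sub, map_one, expand_X]
    have e' : ∀ u : B[X], componentHom hp i ((1 - C b) * u) = (1 - C b) * componentHom hp i u := by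
      intro u
      rw [← componentHom_expand_mul hp hi, map_sub, map_one, expand_C]
    refine span_pair_pow_induction
      (P := fun f => componentHom hp i f ∈ Ideal.span {1 - X, 1 - C b} ^ (k + 1)) hf (fun u hu => ?_) (fun u hu => ?_) (fun u v hu hv => ?_)
    · rw [e, pow_succ']
      exact Ideal.mul_mem_mul (Ideal.subset_span (by simp)) (ih hu)
    · rw [e', pow_succ']
      exact Ideal.mul_mem_mul (Ideal.subset_span (by simp)) (ih hu)
    · rw [map_add]
      exact add_mem hu hv

lemma exists_componentHom_X_pow (hi : i < p) (n : ℕ) :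
    componentHom hp i (X ^ n : B[X]) = 0 ∨ ∃ m, componentHom hp i (X ^ n : B[X]) = X ^ m := by
  by_cases h : n % p = i
  · right
    refine ⟨n / p, ?_⟩
    conv_lhs => rw [← Nat.div_add_mod n p, h]
    exact componentHom_X_pow_mul_add hp _
  · exact Or.inl (componentHom_X_pow_eq_zero hp hi h)

end Component

/-! ### The shift x ↦ x q^p, and first-order expansion at x = 1. -/

section Shift

open Polynomial

/-- The substitution `x ↦ x q ^ p` on polynomials in `q` over `ℤ[x]`. -/
noncomputable def shift (p : ℕ) : ℤ[X][X] →+* ℤ[X][X] :=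
  eval₂RingHom (eval₂RingHom (Int.castRingHom ℤ[X][X]) (X ^ p * C X)) X

@[simp] lemma shift_X (p : ℕ) : shift p X = X := by simp [shift]

@[simp] lemma shift_C_X (p : ℕ) : shift p (C X) = X ^ p * C X := by simp [shift]

lemma shift_C (p : ℕ) (a : ℤ[X]) : shift p (C a) = expand _ p (shift 1 (C a)) := by
  have : (shift p).comp C = ((expand ℤ[X] p).toRingHom.comp (shift 1)).comp C := by
    ext <;> simp
  exact DFunLike.congr_fun this a

lemma componentHom_shift {p i : ℕ} (hp : 0 < p) (hi : i < p) (f : ℤ[X][X]) :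
    componentHom hp i (shift p f) = shift 1 (componentHom hp i f) := by
  induction f using Polynomial.induction_on' with
  | add f g hf hg => simp only [map_add, hf, hg]
  | monomial n a =>
    rw [← C_mul_X_pow_eq_monomial, map_mul, shift_C, componentHom_expand_mul hp hi,
      componentHom_C_mul, map_mul, map_pow, shift_X]
    rcases exists_componentHom_X_pow (B := ℤ[X]) hp hi n with h | ⟨m, h⟩ <;> simp [h]

lemma one_sub_X_dvd_shift_sub (f : ℤ[X][X]) : 1 - X ∣ shift 1 f - f := by
  have : (Ideal.Quotient.mk (Ideal.span {1 - X})).comp (shift 1) =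
      Ideal.Quotient.mk (Ideal.span {(1 - X : ℤ[X][X])}) := by
    have hX : Ideal.Quotient.mk (Ideal.span {(1 - X : ℤ[X][X])}) X = 1 :=
      (Ideal.Quotient.mk_eq_mk_iff_sub_mem 1 X |>.2 (Ideal.subset_span (by simp))).symm
    ext <;> simp [hX]
    exact mul_one (M := ℤ[X][X] ⧸ Ideal.span {(1 - X : ℤ[X][X])}) _
  rw [← Ideal.mem_span_singleton, ← Ideal.Quotient.mk_eq_mk_iff_sub_mem]
  exact DFunLike.congr_fun this f

/-- The substitution `x ↦ 1 - ε`. -/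
noncomputable def toDual : ℤ[X][X] →+* DualNumber ℤ[X] :=
  eval₂RingHom (eval₂RingHom (Int.castRingHom _) (1 - DualNumber.eps))
    (algebraMap ℤ[X] (DualNumber ℤ[X]) X)

lemma fst_toDual (f : ℤ[X][X]) :
    TrivSqZeroExt.fst (toDual f) = f.map (evalRingHom 1) := by
  have : (TrivSqZeroExt.fstHom ℤ[X] ℤ[X] ℤ[X]).toRingHom.comp toDual =
      mapRingHom (evalRingHom 1) := by
    ext <;> simp [toDual]
  exact DFunLike.congr_fun this f

/-- Each generator 1 - x maps to ε and can be used at most once, so the ε-coefficient loses at most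
one factor 1 - q. Multiplying it by 1 - q avoids the exponent k - 1. -/
lemma dvd_toDual {k : ℕ} {f : ℤ[X][X]} (hf : f ∈ Ideal.span {1 - X, 1 - C X} ^ k) :
    (1 - X) ^ k ∣ TrivSqZeroExt.fst (toDual f) ∧
      (1 - X) ^ k ∣ (1 - X) * TrivSqZeroExt.snd (toDual f) := by
  induction k generalizing f with
  | zero => simp
  | succ k ih =>
    have h1 : toDual (1 - X) = TrivSqZeroExt.inl (1 - X) := by
      rw [map_sub, map_one, TrivSqZeroExt.inl_sub, TrivSqZeroExt.inl_one]
      simp [toDual, TrivSqZeroExt.algebraMap_eq_inl]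
    have h2 : toDual (1 - C X) = DualNumber.eps := by simp [toDual]
    refine span_pair_pow_induction
      (P := fun f => (1 - X) ^ (k + 1) ∣ TrivSqZeroExt.fst (toDual f) ∧
        (1 - X) ^ (k + 1) ∣ (1 - X) * TrivSqZeroExt.snd (toDual f)) hf (fun u hu => ?_) (fun u hu => ?_) (fun u v hu hv => ?_)
    · obtain ⟨⟨s, hs⟩, ⟨t, ht⟩⟩ := ih hu
      rw [map_mul, h1]
      refine ⟨⟨s, ?_⟩, ⟨t, ?_⟩⟩
      · simp [hs]
        ring
      · simp
        linear_combination (1 - X) * ht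
    · obtain ⟨⟨s, hs⟩, -⟩ := ih hu
      rw [map_mul, h2]
      refine ⟨by simp, ⟨s, ?_⟩⟩
      simp [hs]
      ring
    · simp only [map_add, TrivSqZeroExt.fst_add, TrivSqZeroExt.snd_add, mul_add]
      exact ⟨dvd_add hu.1 hv.1, dvd_add hu.2 hv.2⟩

/-- If `(1 - x) H` lies in a power of the ideal `(1 - q, 1 - x)`, up to a power of two, then
`H` at `x = 1` is divisible by a power of `1 - q`. -/
lemma dvd_map_eval_of_mem {M n : ℕ} {H : ℤ[X][X]}
    (h : 2 ^ M * ((1 - C X) * H) ∈ Ideal.span {1 - X, 1 - C X} ^ (n + 1)) :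
    (1 - X) ^ n ∣ H.map (evalRingHom 1) := by
  obtain ⟨t, ht⟩ := (dvd_toDual h).2
  have h2 : toDual (1 - C X) = DualNumber.eps := by simp [toDual]
  have e : toDual (2 ^ M * ((1 - C X) * H)) = DualNumber.eps * toDual (2 ^ M * H) := by
    rw [mul_left_comm, map_mul, h2]
  rw [e] at ht
  have e' : TrivSqZeroExt.snd (DualNumber.eps * toDual (2 ^ M * H)) =
      2 ^ M * H.map (evalRingHom 1) := by
    simp [fst_toDual, -map_mul]
  rw [e', pow_succ', mul_assoc] at ht
  have h0 : (1 - X : ℤ[X]) ≠ 0 := fun h => by simpa using congrArg (eval 0) h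
  have h4 := mul_left_cancel₀ h0 ht
  have h5 : Prime (1 - X : ℤ[X]) := by
    rw [← neg_sub]
    exact (prime_X_sub_C 1).neg
  -- The prime 1 - q does not divide 2^M, whose value at q = 1 is nonzero, so the power of two
  -- cancels.
  refine h5.pow_dvd_of_dvd_mul_left n (fun hd => ?_) ⟨t, h4⟩
  have := eval_dvd (x := 1) hd
  simp at this

end Shift

/-! ### Congruences modulo 24 and the symbol (12/p). -/

section Arithmetic

variable {p i₀ : ℕ}

/-- Writing 24 i₀ + 1 = p w with w < 24, one has p w ≡ 1 mod 24. Units modulo 24 are their own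
inverses, so w = p mod 24. Thus (p² - 1)/24 has quotient ⌊p/24⌋ and remainder i₀ on division by p.
-/
lemma quotient_identity (hi₀p : i₀ ≤ p - 1) (hp0 : 0 < p) (hcong : 24 * (i₀ : ℤ) ≡ -1 [ZMOD p]) :
    24 * (p * (p / 24) + i₀) + 1 = p * p := by
  have hd : p ∣ 24 * i₀ + 1 := by
    have h := (Int.modEq_iff_dvd.1 hcong.symm)
    rw [sub_neg_eq_add] at h
    exact_mod_cast h
  obtain ⟨w, hw⟩ := hd
  have hw24 : w < 24 := by
    by_contra h
    have : p * 24 ≤ p * w := Nat.mul_le_mul_left p (by omega)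
    omega
  have key : ∀ t < 24, ∀ w < 24, t * w % 24 = 1 → w = t := by decide
  have h1 : p % 24 * w % 24 = 1 := by
    rw [Nat.mod_mul_mod, ← hw]
    omega
  have h2 := key _ (Nat.mod_lt p (by norm_num)) w hw24 h1
  have h3 := Nat.div_add_mod p 24
  rw [← h2] at h3
  calc 24 * (p * (p / 24) + i₀) + 1 = p * (24 * (p / 24)) + (24 * i₀ + 1) := by ring
    _ = p * (24 * (p / 24) + w) := by rw [hw]; ring
    _ = p * p := by rw [h3]

lemma dvd_of_mod_eq (hcong : 24 * (i₀ : ℤ) ≡ -1 [ZMOD p]) {e : ℕ} (he : e % p = i₀) :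
    p ∣ 24 * e + 1 := by
  have h1 : (e : ℤ) ≡ i₀ [ZMOD p] := by
    rw [← he]; push_cast; exact (Int.mod_modEq _ _).symm
  have h2 : 24 * (e : ℤ) ≡ -1 [ZMOD p] := (h1.mul_left 24).trans hcong
  have h := (Int.modEq_iff_dvd.1 h2.symm)
  rw [sub_neg_eq_add] at h
  exact_mod_cast h

lemma twentyfour_mul_pent (j : ℕ) : 24 * pent j + 1 = (6 * j + 1) ^ 2 := by
  have := two_mul_pent j
  nlinarith

lemma twentyfour_mul_pent' (j : ℕ) : 24 * (pent j + (2 * j + 1)) + 1 = (6 * j + 5) ^ 2 := by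
  have := two_mul_pent j
  nlinarith

lemma jacobiSym_twelve (p : ℕ) (h : p % 6 = 1 ∨ p % 6 = 5) :
    jacobiSym 12 p = if p % 6 = 1 then (-1) ^ (p / 6) else -(-1) ^ (p / 6) := by
  have ho : Odd p := by rw [Nat.odd_iff]; omega
  -- The symbol has period 4 · 12 = 48 in p, which also preserves p mod 6 and the parity of ⌊p/6⌋.
  rw [jacobiSym.mod_right 12 ho]
  have h6 : p % 6 = p % 48 % 6 := by omega
  have h2 : p / 6 % 2 = p % 48 / 6 % 2 := by omega
  rw [neg_one_pow_eq_pow_mod_two (R := ℤ), h2, h6]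
  rw [h6] at h
  have hm : p % 48 < 48 := Nat.mod_lt _ (by norm_num)
  change jacobiSym 12 (p % 48) = _
  generalize p % 48 = m at h hm ⊢
  interval_cases m <;> first | omega | norm_num

end Arithmetic

/-! ### Dissecting the theta sum and the two functional equations. -/

section Theta

open Polynomial

variable {p i₀ : ℕ}

lemma componentHom_X_pow_of_eq (hp0 : 0 < p) (hi₀p : i₀ ≤ p - 1)
    (hcong : 24 * (i₀ : ℤ) ≡ -1 [ZMOD p]) {e t : ℕ} (he : 24 * e + 1 = (24 * t + 1) * (p * p)) :
    componentHom hp0 i₀ (X ^ e : ℤ[X][X]) = X ^ (p / 24 + t * p) := by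
  have h := quotient_identity hi₀p hp0 hcong
  have : e = p * (p / 24 + t * p) + i₀ := by nlinarith
  rw [this, componentHom_X_pow_mul_add]

lemma componentHom_X_pow_of_not_dvd (hp0 : 0 < p) (hi₀p : i₀ ≤ p - 1)
    (hcong : 24 * (i₀ : ℤ) ≡ -1 [ZMOD p]) {e : ℕ} (he : ¬ p ∣ 24 * e + 1) :
    componentHom hp0 i₀ (X ^ e : ℤ[X][X]) = 0 :=
  componentHom_X_pow_eq_zero hp0 (by omega) fun h => he (dvd_of_mod_eq hcong h)

/-- Completing the square, an exponent e survives only if p divides 6j + 1 or 6j + 5, whose squares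
are the values of 24e + 1. For j < p each case has one solution: one of the two numbers equals p and
the other 5p. -/
lemma componentHom_theta (hp : p.Prime) (hp5 : 5 ≤ p) (hi₀p : i₀ ≤ p - 1)
    (hcong : 24 * (i₀ : ℤ) ≡ -1 [ZMOD p]) :
    componentHom hp.pos i₀ (∑ j ∈ range p, (-1) ^ j * X ^ pent j * (C (X : ℤ[X])) ^ (3 * j) *
        (1 - X ^ (2 * j + 1) * (C (X : ℤ[X])) ^ 2) : ℤ[X][X]) =
      (jacobiSym 12 p : ℤ[X][X]) * X ^ (p / 24) * (C (X : ℤ[X])) ^ ((p - 1) / 2) *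
        (1 - X ^ p * (C (X : ℤ[X])) ^ (2 * p)) := by
  have hmod : p % 6 = 1 ∨ p % 6 = 5 := by
    have h2 := (hp.eq_one_or_self_of_dvd 2)
    have h3 := (hp.eq_one_or_self_of_dvd 3)
    omega
  have e : ∀ j, ((-1) ^ j * X ^ pent j * (C (X : ℤ[X])) ^ (3 * j) *
        (1 - X ^ (2 * j + 1) * (C (X : ℤ[X])) ^ 2) : ℤ[X][X]) =
      C ((-1) ^ j * (X : ℤ[X]) ^ (3 * j)) * X ^ pent j -
        C ((-1) ^ j * (X : ℤ[X]) ^ (3 * j + 2)) * X ^ (pent j + (2 * j + 1)) := by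
    intro j
    simp only [map_mul, map_pow, map_neg, map_one]
    ring
  have d1 : ∀ j, p ∣ 24 * pent j + 1 → p ∣ 6 * j + 1 := fun j h => by
    rw [twentyfour_mul_pent] at h; exact hp.dvd_of_dvd_pow h
  have d2 : ∀ j, p ∣ 24 * (pent j + (2 * j + 1)) + 1 → p ∣ 6 * j + 5 := fun j h => by
    rw [twentyfour_mul_pent'] at h; exact hp.dvd_of_dvd_pow h
  simp only [e, sum_sub_distrib, map_sub, map_sum, componentHom_C_mul]
  rw [jacobiSym_twelve p hmod]
  rcases hmod with h | h
  · obtain ⟨r, rfl⟩ : ∃ r, p = 6 * r + 1 := ⟨p / 6, by omega⟩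
    -- Here 6r + 1 = p and 6(5r) + 5 = 5p.
    rw [sum_eq_single r, sum_eq_single (5 * r)]
    · rw [componentHom_X_pow_of_eq hp.pos hi₀p hcong (t := 0)
          (by rw [twentyfour_mul_pent]; ring),
        componentHom_X_pow_of_eq hp.pos hi₀p hcong (t := 1)
          (by rw [twentyfour_mul_pent']; ring), if_pos h,
        show (6 * r + 1) / 6 = r by omega, show (6 * r + 1 - 1) / 2 = 3 * r by omega]
      simp only [map_mul, map_pow, map_neg, map_one, Int.cast_pow, Int.cast_neg, Int.cast_one]
      linear_combination -(C (X : ℤ[X])) ^ (15 * r + 2) * X ^ ((6 * r + 1) / 24 + (6 * r + 1)) *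
        neg_one_pow_five_mul (R := ℤ[X][X]) r
    · intro j hj hne
      rw [componentHom_X_pow_of_not_dvd hp.pos hi₀p hcong, mul_zero]
      intro hd
      obtain ⟨c, hc⟩ := d2 j hd
      have hj' := mem_range.1 hj
      have : c < 7 := by nlinarith
      interval_cases c <;> omega
    · intro hn
      exact absurd (mem_range.2 (by omega)) hn
    · intro j hj hne
      rw [componentHom_X_pow_of_not_dvd hp.pos hi₀p hcong, mul_zero]
      intro hd
      obtain ⟨c, hc⟩ := d1 j hd
      have hj' := mem_range.1 hj
      have : c < 7 := by nlinarith
      interval_cases c <;> omega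
    · intro hn
      exact absurd (mem_range.2 (by omega)) hn
  · obtain ⟨r, rfl⟩ : ∃ r, p = 6 * r + 5 := ⟨p / 6, by omega⟩
    -- Here 6(5r + 4) + 1 = 5p and 6r + 5 = p.
    rw [sum_eq_single (5 * r + 4), sum_eq_single r]
    · rw [componentHom_X_pow_of_eq hp.pos hi₀p hcong (t := 1)
          (by rw [twentyfour_mul_pent]; ring),
        componentHom_X_pow_of_eq hp.pos hi₀p hcong (t := 0)
          (by rw [twentyfour_mul_pent']; ring), if_neg (by omega),
        show (6 * r + 5) / 6 = r by omega, show (6 * r + 5 - 1) / 2 = 3 * r + 2 by omega]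
      simp only [map_mul, map_pow, map_neg, map_one, Int.cast_pow, Int.cast_neg, Int.cast_one]
      linear_combination (C (X : ℤ[X])) ^ (15 * r + 12) * X ^ ((6 * r + 5) / 24 + (6 * r + 5)) *
        neg_one_pow_five_mul (R := ℤ[X][X]) r
    · intro j hj hne
      rw [componentHom_X_pow_of_not_dvd hp.pos hi₀p hcong, mul_zero]
      intro hd
      obtain ⟨c, hc⟩ := d2 j hd
      have hj' := mem_range.1 hj
      have : c < 7 := by nlinarith
      interval_cases c <;> omega
    · intro hn
      exact absurd (mem_range.2 (by omega)) hn
    · intro j hj hne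
      rw [componentHom_X_pow_of_not_dvd hp.pos hi₀p hcong, mul_zero]
      intro hd
      obtain ⟨c, hc⟩ := d1 j hd
      have hj' := mem_range.1 hj
      have : c < 7 := by nlinarith
      interval_cases c <;> omega
    · intro hn
      exact absurd (mem_range.2 (by omega)) hn

/-- The dissected functional equation. -/
lemma componentHom_partialG_add_mem (hp : p.Prime) (hp5 : 5 ≤ p) (hi₀p : i₀ ≤ p - 1)
    (hcong : 24 * (i₀ : ℤ) ≡ -1 [ZMOD p]) (t : ℕ) {D : ℤ[X][X]}
    (hD : D = componentHom hp.pos i₀ ((1 - C (X : ℤ[X])) * partialG (C (X : ℤ[X])) X (p * t))) :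
    D + X ^ ((3 * p + 1) / 2) * (C (X : ℤ[X])) ^ (3 * p) * shift 1 D -
      (jacobiSym 12 p : ℤ[X][X]) * X ^ (p / 24) * (C (X : ℤ[X])) ^ ((p - 1) / 2) *
        (1 - X ^ p * (C (X : ℤ[X])) ^ (2 * p)) ∈ Ideal.span {(1 - X : ℤ[X][X]), 1 - C (X : ℤ[X])} ^ t := by
  have hodd : Odd p := hp.odd_of_ne_two (by omega)
  have hlt : i₀ < p := by omega
  set c : ℤ[X][X] := X ^ ((3 * p + 1) / 2) * (C (X : ℤ[X])) ^ (3 * p) with hc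
  -- The prefactor of the iterated equation is thus a polynomial in q^p and passes through the
  -- dissection.
  have hpent : pent p = p * ((3 * p + 1) / 2) := by
    have h2 : 2 ∣ 3 * p + 1 := by have := hodd; rw [Nat.odd_iff] at this; omega
    rw [pent, Nat.mul_div_assoc _ h2]
  have he : expand ℤ[X] p c = X ^ pent p * (C (X : ℤ[X])) ^ (3 * p) := by
    rw [hc, hpent]; simp [← pow_mul]
  have hshift : shift p ((1 - C (X : ℤ[X])) * partialG (C (X : ℤ[X])) X (p * t)) =
      (1 - X ^ p * C (X : ℤ[X])) * partialG (X ^ p * C (X : ℤ[X])) X (p * t) := by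
    rw [map_mul, map_partialG]; simp
  have hit := partialG_iterate_of_odd (C (X : ℤ[X])) (X : ℤ[X][X]) (p * t) hodd
  rw [← hshift] at hit
  rw [← componentHom_theta hp hp5 hi₀p hcong, hD, ← componentHom_shift hp.pos hlt,
    ← componentHom_expand_mul hp.pos hlt, ← map_add, ← map_sub]
  refine componentHom_mem_pow hp.pos hlt _ _ ?_
  rw [he]
  have hB : ∑ j ∈ range p, (-1) ^ j * X ^ pent j * (C (X : ℤ[X])) ^ (3 * j) *
      boundary (X ^ j * C (X : ℤ[X])) X (p * t) ∈ Ideal.span {(1 - X ^ p : ℤ[X][X]), 1 - C (X : ℤ[X])} ^ t :=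
    sum_mem fun j _ => Ideal.mul_mem_left _ _ (boundary_mem_pow _ _ hp.pos j t)
  convert neg_mem hB using 1
  linear_combination hit

/-- The functional equation after `(x, q) ↦ (x ^ p, q ^ p)`. -/
lemma partialG_pow_add_mem (hp : p.Prime) (hp5 : 5 ≤ p) (u : ℤ) (t : ℕ) {D : ℤ[X][X]}
    (hD : D = (u : ℤ[X][X]) * X ^ (p / 24) * (C (X : ℤ[X])) ^ ((p - 1) / 2) *
      ((1 - (C (X : ℤ[X])) ^ p) * partialG ((C (X : ℤ[X])) ^ p) (X ^ p) t)) :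
    D + X ^ ((3 * p + 1) / 2) * (C (X : ℤ[X])) ^ (3 * p) * shift 1 D -
      (u : ℤ[X][X]) * X ^ (p / 24) * (C (X : ℤ[X])) ^ ((p - 1) / 2) *
        (1 - X ^ p * (C (X : ℤ[X])) ^ (2 * p)) ∈ Ideal.span {(1 - X : ℤ[X][X]), 1 - C (X : ℤ[X])} ^ t := by
  obtain ⟨r, rfl⟩ : ∃ r, p = 2 * r + 1 := hp.odd_of_ne_two (by omega)
  -- The shift turns x^((p-1)/2) into q^((p-1)/2) x^((p-1)/2), raising q^((3p+1)/2) to the q^(2p) of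
  -- the functional equation in (x^p, q^p).
  have h1 : shift 1 D = (u : ℤ[X][X]) * X ^ ((2 * r + 1) / 24) * (X * C (X : ℤ[X])) ^ r *
      ((1 - X ^ (2 * r + 1) * (C (X : ℤ[X])) ^ (2 * r + 1)) *
        partialG (X ^ (2 * r + 1) * (C (X : ℤ[X])) ^ (2 * r + 1)) (X ^ (2 * r + 1)) t) := by
    rw [hD]
    simp only [map_mul, map_partialG, map_pow, map_sub, map_one, shift_X, shift_C_X, map_intCast,
      pow_one, mul_pow]
    rw [show (2 * r + 1 - 1) / 2 = r by omega]
  rw [h1, hD, partialG_functional_equation]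
  have h2 := Ideal.mul_mem_left _
    (-((u : ℤ[X][X]) * X ^ ((2 * r + 1) / 24) * (C (X : ℤ[X])) ^ r))
    (boundary_pow_mem_pow (C (X : ℤ[X])) X (2 * r + 1) t)
  convert h2 using 1
  rw [show (2 * r + 1 - 1) / 2 = r by omega, show (3 * (2 * r + 1) + 1) / 2 = 3 * r + 2 by omega]
  ring

end Theta

/-! ### Specialization at x = 1 and comparison with the power series. -/

section Final

open Polynomial

variable {p i₀ : ℕ}

lemma dvd_component_partialG_sub (hp : p.Prime) (hp5 : 5 ≤ p) (hi₀p : i₀ ≤ p - 1)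
    (hcong : 24 * (i₀ : ℤ) ≡ -1 [ZMOD p]) (n : ℕ) :
    (1 - X) ^ n ∣ (componentHom hp.pos i₀ (partialG 1 X (p * (n + 1))) : ℤ[X]) -
      (jacobiSym 12 p : ℤ[X]) * X ^ (p / 24) * ((p : ℤ[X]) * partialG 1 (X ^ p) (n + 1)) := by
  set E : ℤ[X][X] := (jacobiSym 12 p : ℤ[X][X]) * X ^ (p / 24) * (C (X : ℤ[X])) ^ ((p - 1) / 2)
    with hE
  set G₁ : ℤ[X][X] := partialG (C (X : ℤ[X])) X (p * (n + 1)) with hG₁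
  set G₂ : ℤ[X][X] := partialG ((C (X : ℤ[X])) ^ p) (X ^ p) (n + 1) with hG₂
  set D₁ : ℤ[X][X] := componentHom hp.pos i₀ ((1 - C (X : ℤ[X])) * G₁) with hD₁
  set D₂ : ℤ[X][X] := E * ((1 - (C (X : ℤ[X])) ^ p) * G₂) with hD₂
  have h1 := componentHom_partialG_add_mem hp hp5 hi₀p hcong (n + 1) hD₁
  have h2 := partialG_pow_add_mem hp hp5 (jacobiSym 12 p) (n + 1) hD₂
  have h3 := sub_mem h1 h2
  obtain ⟨M, hM⟩ := exists_two_pow_mul_mem (h := (1 - X : ℤ[X][X])) (y := 1 - C (X : ℤ[X]))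
    (σ := shift 1) one_sub_X_dvd_shift_sub (by simp)
    (c := (C (X : ℤ[X])) ^ (3 * p) * X ^ ((3 * p + 1) / 2)) (D := D₁ - D₂)
    (one_sub_pow_mul_pow_mem _ _ _ _) (n + 1) (by
      convert h3 using 1
      rw [map_sub]
      ring)
  have h4 : D₁ - D₂ = (1 - C (X : ℤ[X])) *
      (componentHom hp.pos i₀ G₁ - E * ((∑ i ∈ range p, (C (X : ℤ[X])) ^ i) * G₂)) := by
    have e : (1 - C X : ℤ[X][X]) = C (1 - X) := by simp
    rw [hD₁, hD₂, ← mul_neg_geom_sum, e, componentHom_C_mul]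
    ring
  rw [h4] at hM
  convert dvd_map_eval_of_mem hM using 1
  have e1 : G₁.map (evalRingHom 1) = partialG 1 X (p * (n + 1)) := by
    rw [hG₁, ← coe_mapRingHom, map_partialG]; simp
  have e2 : G₂.map (evalRingHom 1) = partialG 1 (X ^ p) (n + 1) := by
    rw [hG₂, ← coe_mapRingHom, map_partialG]; simp
  rw [Polynomial.map_sub, ← componentHom_map, e1, Polynomial.map_mul, Polynomial.map_mul (p := ∑ _ ∈ _, _), e2]
  simp [hE, Polynomial.map_sum]

lemma dvd_componentHom_of_mem (hp0 : 0 < p) (hi : i₀ < p) {n : ℕ} {f : ℤ[X]}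
    (hf : f ∈ Ideal.span {1 - X ^ p, 1 - 1} ^ n) :
    (1 - X) ^ n ∣ componentHom hp0 i₀ f := by
  have h := componentHom_mem_pow hp0 hi (1 : ℤ) n (f := f) (by rwa [C_1])
  rwa [C_1, sub_self, Ideal.span_pair_zero, Ideal.span_singleton_pow,
    Ideal.mem_span_singleton] at h

/-- Dividing by 1 - x costs one power, so the comparison uses p(n + 1) terms; the extra p terms are
negligible modulo (1 - q)^n. -/
lemma dvd_componentHom_partialG_sub (hp0 : 0 < p) (hi : i₀ < p) {n : ℕ} (hn : 0 < n) :
    (1 - X) ^ n ∣ componentHom hp0 i₀ (partialG 1 (X : ℤ[X]) (p * (n + 1))) -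
      A p (p * n - 1) i₀ := by
  have hpn : 0 < p * n := Nat.mul_pos hp0 hn
  have e : A p (p * n - 1) i₀ = componentHom hp0 i₀ (partialG 1 (X : ℤ[X]) (p * n)) := by
    have : truncF (p * n - 1) = partialG 1 (X : ℤ[X]) (p * n) := by
      simp [truncF, partialG, Nat.sub_add_cancel hpn]
    rw [A, this]
    rfl
  rw [e, ← map_sub]
  refine dvd_componentHom_of_mem hp0 hi ?_
  rw [partialG, partialG, mul_add, mul_one, sum_range_add, add_sub_cancel_left]
  refine sum_mem fun m _ => Ideal.mul_mem_left _ _ ?_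
  rw [qPoch, prod_range_add]
  refine Ideal.mul_mem_right _ _ ?_
  simpa [qPoch] using qPoch_mem_pow (1 : ℤ[X]) X hp0 1 n

lemma X_pow_dvd_F_sub {u : PowerSeries ℤ} (hu : PowerSeries.constantCoeff u = 1) (n : ℕ) :
    PowerSeries.X ^ n ∣ F u - ∑ m ∈ range (n + 1), qPoch u u m := by
  rw [PowerSeries.X_pow_dvd_iff]
  intro k hk
  rw [map_sub, coeff_F hu, map_sum, sub_eq_zero]
  refine sum_subset (fun m hm => ?_) (fun m _ hm => ?_)
  · rw [mem_range] at hm ⊢; omega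
  · exact coeff_qPoch_eq_zero hu (by rw [mem_range] at hm; omega)

end Final

end Fishburn

open Polynomial in
theorem mainTheorem2 (p : ℕ) (hp : p.Prime) (hp5 : 5 ≤ p)
    (i₀ : ℕ) (hi₀ : 1 ≤ i₀) (hi₀p : i₀ ≤ p - 1) (hcong : 24 * (i₀ : ℤ) ≡ -1 [ZMOD p])
    (n k : ℕ) (hk : k < n) :
    Fishburn.alpha p n i₀ k = (p : ℤ) * jacobiSym 12 p * Fishburn.xiBar p k := by
  have h1 := dvd_sub (Fishburn.dvd_component_partialG_sub hp hp5 hi₀p hcong n)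
    (Fishburn.dvd_componentHom_partialG_sub hp.pos (show i₀ < p by omega) (show 0 < n by omega))
  rw [sub_sub_sub_cancel_left] at h1
  let φ : ℤ[X] →+* PowerSeries ℤ := coeToPowerSeries.ringHom.comp (compRingHom (1 - X))
  have h2 := map_dvd φ h1
  have hX : φ X = 1 - PowerSeries.X := by simp [φ]
  have hu : PowerSeries.constantCoeff ((1 - PowerSeries.X) ^ p : PowerSeries ℤ) = 1 := by simp
  have h3 := Dvd.dvd.mul_left (Fishburn.X_pow_dvd_F_sub hu n)
    ((p : PowerSeries ℤ) * (jacobiSym 12 p : PowerSeries ℤ) * (1 - PowerSeries.X) ^ (p / 24))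
  simp only [map_pow, map_sub, map_mul, map_one, map_intCast, map_natCast,
    Fishburn.map_partialG, hX, sub_sub_cancel] at h2
  have h4 := dvd_sub h2 h3
  have h5 := PowerSeries.X_pow_dvd_iff.1 h4 k hk
  have h6 : PowerSeries.coeff k (φ (Fishburn.A p (p * n - 1) i₀)) = Fishburn.alpha p n i₀ k := by
    simp [φ, Fishburn.alpha]
  have h7 : PowerSeries.coeff k ((p : PowerSeries ℤ) * (jacobiSym 12 p : PowerSeries ℤ) *
      ((1 - PowerSeries.X) ^ (p / 24) * Fishburn.F ((1 - PowerSeries.X) ^ p))) =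
      (p : ℤ) * jacobiSym 12 p * Fishburn.xiBar p k := by
    rw [Fishburn.xiBar, ← PowerSeries.coeff_C_mul]
    simp
  rw [← h6, ← h7, ← sub_eq_zero, ← map_sub, ← h5]
  congr 1
  simp only [Fishburn.partialG, one_pow, one_mul]
  ring
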